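/- Let $p_1<p_2<\cdots$ be the prime numbers in increasing order, and let $(X_j)_{j\ge 1}$ be independent random variables with $\mathbb P(X_j=1)=\frac{1}{1+p_j}$ and $\mathbb P(X_j=0)=\frac{p_j}{1+p_j}$. For $n\ge 1$ put $$S_n=\frac{1}{\log p_n}\sum_{j=1}^n X_j\log p_j .$$ Let $Z$ follow the Dickman distribution (with $\theta=1$), i.e. the law on $\mathbb R$ with characteristic function $$\mathbb E\big[e^{itZ}\big]=\exp\left(\int_0^1\frac{e^{itx}-1}{x}\,dx\right),\qquad t\in\mathbb R .$$ For real random variables $X,Y$ let $$\mathcal W_3(X,Y)=\sup_{h\in\mathcal H_3}\big|\mathbb E[h(X)]-\mathbb E[h(Y)]\big|,\qquad \mathcal H_3=\{h\in C^3(\mathbb R):\ \|h^{(k)}\|_\infty\le 1\ \text{ for all } 0\le k\le 3\}.$$ For $n\ge 3$ let $\Delta_n=\frac{\log\log n}{\log n}$. Then there is an absolute constant $C>0$ such that, for all $n\ge 3$, $$\mathcal W_3(S_n,Z)\le C\,\Delta_n\sqrt{-\log \Delta_n}.$$ In particular, $$\mathcal W_3(S_n,Z)=\mathcal O\left(\frac{(\log\log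 n)^{3/2}}{\log n}\right)\qquad (n\to\infty).$$ -/

import Mathlib

open MeasureTheory ProbabilityTheory Filter Asymptotics

/-- The class `H_p` of test functions: `h ∈ C^p(ℝ)` with `‖h^{(k)}‖_∞ ≤ 1` for all `0 ≤ k ≤ p`. -/
def smoothTestFunctions (p : ℕ) : Set (ℝ → ℝ) :=
  {h | ContDiff ℝ p h ∧ ∀ k ≤ p, ∀ x : ℝ, |iteratedDeriv k h x| ≤ 1}

/-- The smooth Wasserstein distance `W_p` between two probability laws on `ℝ`:
the supremum of `|𝔼 h(X) - 𝔼 h(Y)|` over `h ∈ H_p`, for `X ∼ μ` and `Y ∼ ν`.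
For probability measures the supremum is over a nonempty set bounded by `2`
(see `smoothWasserstein_bddAbove`), so it is the genuine one. -/
noncomputable def smoothWasserstein (p : ℕ) (μ ν : Measure ℝ) : ℝ :=
  sSup ((fun h : ℝ → ℝ => |(∫ x, h x ∂μ) - ∫ x, h x ∂ν|) '' smoothTestFunctions p)

theorem zero_mem_smoothTestFunctions (p : ℕ) : (fun _ => 0) ∈ smoothTestFunctions p := by
  refine ⟨contDiff_const, fun k _ x => ?_⟩
  rw [iteratedDeriv_const]
  split_ifs <;> simp

theorem smoothWasserstein_bddAbove (p : ℕ) (μ ν : Measure ℝ)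
    [IsProbabilityMeasure μ] [IsProbabilityMeasure ν] :
    BddAbove ((fun h : ℝ → ℝ => |(∫ x, h x ∂μ) - ∫ x, h x ∂ν|) '' smoothTestFunctions p) := by
  refine ⟨2, ?_⟩
  rintro _ ⟨h, hh, rfl⟩
  have hb : ∀ x, ‖h x‖ ≤ 1 := fun x => by
    simpa using hh.2 0 (Nat.zero_le p) x
  have h1 : ‖∫ x, h x ∂μ‖ ≤ 1 := by
    simpa using norm_integral_le_of_norm_le_const (μ := μ) (Eventually.of_forall hb)
  have h2 : ‖∫ x, h x ∂ν‖ ≤ 1 := by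
    simpa using norm_integral_le_of_norm_le_const (μ := ν) (Eventually.of_forall hb)
  rw [Real.norm_eq_abs, abs_le] at h1 h2
  exact abs_le.2 ⟨by linarith, by linarith⟩

/-- `μ` is the (generalized) Dickman distribution with parameter `θ`: the probability law on `ℝ`
with characteristic function `t ↦ exp (θ ∫₀¹ (e^{itx} - 1) / x dx)`. -/
structure IsDickman (θ : ℝ) (μ : Measure ℝ) : Prop where
  isProbabilityMeasure : IsProbabilityMeasure μ
  charFun_eq : ∀ t : ℝ, charFun μ t =
    Complex.exp (θ * ∫ x in (0 : ℝ)..1, (Complex.exp (Complex.I * t * x) - 1) / (x : ℂ))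

/-- The `j`-th prime number, for `j ≥ 1`: `primeSeq 1 = 2`, `primeSeq 2 = 3`, … -/
noncomputable def primeSeq (j : ℕ) : ℕ := Nat.nth Nat.Prime (j - 1)

/-- `(X_j)_{j ≥ 1}` is a sequence of independent random variables with
`P(X_j = 0) = p_j / (1 + p_j)` and `P(X_j = 1) = 1 / (1 + p_j)`; the value `X 0` plays no role. -/
structure IsPrimeBernoulliSeq {Ω : Type*} [MeasurableSpace Ω] (P : Measure Ω)
    (X : ℕ → Ω → ℝ) : Prop where
  measurable : ∀ j, 1 ≤ j → Measurable (X j)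
  indep : iIndepFun (fun j : ℕ => X (j + 1)) P
  prob_zero : ∀ j, 1 ≤ j → P.real {ω | X j ω = 0} = (primeSeq j : ℝ) / (1 + primeSeq j)
  prob_one : ∀ j, 1 ≤ j → P.real {ω | X j ω = 1} = 1 / (1 + (primeSeq j : ℝ))

/-- `S_n = (log p_n)⁻¹ ∑_{j=1}^n X_j log p_j`. -/
noncomputable def primeSum {Ω : Type*} (X : ℕ → Ω → ℝ) (n : ℕ) (ω : Ω) : ℝ :=
  (1 / Real.log (primeSeq n)) * ∑ j ∈ Finset.Icc 1 n, X j ω * Real.log (primeSeq j)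

/-- `Δ_n = log log n / log n`. -/
noncomputable def dickmanDelta (n : ℕ) : ℝ := Real.log (Real.log n) / Real.log n

/-! The argument is Stein's method built on size bias. Differentiating the characteristic function
shows that `E[Z f(Z)] = E[∫₀¹ f(Z + u) du]` (`IsDickman.integral_mul_eq`). The sum `S_n` almost
satisfies the same identity. Put `a_i = log p_i / log p_n` and `q_i = 1 / (1 + p_i)`. By
independence, `E[S_n f(S_n)]` equals `∑ a_i q_i E[f(S_n + a_i)]` up to `∑ (a_i q_i)² = O(1 / log²
p_n)`. Mertens' first theorem and summation by parts show that the masses `a_i q_i` at the points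
`a_i` approximate Lebesgue measure on `[0, 1]` up to `O(1 / log p_n)` against bounded Lipschitz
functions.

To turn this into a distance, one solves `x F(x) - ∫₀¹ F(x + u) du = h(x) - c` with `F` bounded by 1
and 1-Lipschitz (`exists_dickman_stein_solution`). Integrating against the Dickman law forces `c =
E[h(Z)]`, and evaluating at `S_n` bounds `E[h(S_n)] - c` by the two errors above. The outcome is
`O(1 / log p_n)`, hence `O(1 / log n)`, which is sharper than both stated rates. -/

/-! ### Mertens' first theorem -/

theorem Nat.Prime.div_sub_one_le_factorization_factorial {p : ℕ} (hp : p.Prime) (n : ℕ) :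
    (n : ℝ) / p - 1 ≤ n.factorial.factorization p := by
  have h : n / p ≤ n.factorial.factorization p := by
    rw [Nat.factorization_factorial hp (b := Nat.log p n + 2) (by omega)]
    refine le_trans (by simp) (Finset.single_le_sum (f := fun i => n / p ^ i)
      (fun _ _ => Nat.zero_le _) (Finset.mem_Ico.2 ⟨le_refl 1, by omega⟩))
  have h2 : (n : ℝ) / p < (n / p : ℕ) + 1 := by
    rw [← Nat.floor_div_eq_div (K := ℝ)]
    exact Nat.lt_floor_add_one _
  have h3 : ((n / p : ℕ) : ℝ) ≤ n.factorial.factorization p := by exact_mod_cast h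
  linarith

theorem Nat.Prime.factorization_factorial_le_div {p : ℕ} (hp : p.Prime) (n : ℕ) :
    (n.factorial.factorization p : ℝ) ≤ n / (p - 1) := by
  have h := Nat.sub_one_mul_factorization_factorial (n := n) hp
  have h1 : (p - 1) * n.factorial.factorization p ≤ n := by omega
  have hp1 : (1 : ℝ) < p := by exact_mod_cast hp.one_lt
  rw [le_div_iff₀ (by linarith)]
  have h2 : (((p - 1 : ℕ) : ℝ)) * n.factorial.factorization p ≤ n := by exact_mod_cast h1
  rw [Nat.cast_sub hp.one_lt.le] at h2
  push_cast at h2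
  linarith

theorem Real.log_factorial_eq_sum_primesLE (n : ℕ) :
    Real.log n.factorial
      = ∑ p ∈ n.primesLE, (n.factorial.factorization p : ℝ) * Real.log p := by
  rw [Real.log_nat_eq_sum_factorization, Finsupp.sum_of_support_subset _ (s := n.primesLE)]
  · intro p hp
    rw [Nat.support_factorization, Nat.mem_primeFactors] at hp
    exact Nat.mem_primesLE.2 ⟨(hp.1.dvd_factorial).1 hp.2.1, hp.1⟩
  · simp

/-- Upper half of Mertens' first theorem. -/
theorem sum_log_div_prime_le (n : ℕ) (hn : 1 ≤ n) :
    ∑ p ∈ n.primesLE, Real.log p / p ≤ Real.log n + Real.log 4 := by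
  have hn0 : (0 : ℝ) < n := by exact_mod_cast hn
  -- The loss of 1 in each exponent costs `θ(n)` in total, which Chebyshev's bound `θ(n) ≤ n log 4`
  -- absorbs.
  have h1 : ∑ p ∈ n.primesLE, ((n : ℝ) / p - 1) * Real.log p ≤ Real.log n.factorial := by
    rw [Real.log_factorial_eq_sum_primesLE]
    refine Finset.sum_le_sum fun p hp => ?_
    exact mul_le_mul_of_nonneg_right
      ((Nat.prime_of_mem_primesLE hp).div_sub_one_le_factorization_factorial n)
      (Real.log_natCast_nonneg p)
  have h2 : Real.log n.factorial ≤ n * Real.log n := by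
    rw [← Real.log_pow]
    refine Real.log_le_log (by exact_mod_cast n.factorial_pos) ?_
    exact_mod_cast n.factorial_le_pow
  have h3 := Chebyshev.theta_le_log4_mul_x hn0.le
  rw [Chebyshev.theta_eq_sum_primesLE_log] at h3
  have h4 : ∑ p ∈ n.primesLE, ((n : ℝ) / p - 1) * Real.log p
      = n * ∑ p ∈ n.primesLE, Real.log p / p - ∑ p ∈ n.primesLE, Real.log p := by
    rw [Finset.mul_sum, ← Finset.sum_sub_distrib]
    refine Finset.sum_congr rfl fun p _ => ?_
    ring
  have h5 : (n : ℝ) * ∑ p ∈ n.primesLE, Real.log p / p ≤ n * (Real.log n + Real.log 4) := by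
    linarith
  exact le_of_mul_le_mul_left h5 hn0

/-- Lower half of Mertens' first theorem. -/
theorem le_sum_log_div_prime_sub_one (n : ℕ) (hn : 1 ≤ n) :
    Real.log n - 1 ≤ ∑ p ∈ n.primesLE, Real.log p / (p - 1) := by
  have hn0 : (0 : ℝ) < n := by exact_mod_cast hn
  have h1 : Real.log n.factorial ≤ ∑ p ∈ n.primesLE, ((n : ℝ) / (p - 1)) * Real.log p := by
    rw [Real.log_factorial_eq_sum_primesLE]
    refine Finset.sum_le_sum fun p hp => ?_
    exact mul_le_mul_of_nonneg_right
      ((Nat.prime_of_mem_primesLE hp).factorization_factorial_le_div n)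
      (Real.log_natCast_nonneg p)
  have h2 := Stirling.le_log_factorial_stirling (n := n) (by omega)
  have h3 : 0 ≤ Real.log (2 * Real.pi) := Real.log_nonneg (by linarith [Real.pi_gt_three])
  have h4 : 0 ≤ Real.log n := Real.log_natCast_nonneg n
  have h5 : ∑ p ∈ n.primesLE, ((n : ℝ) / (p - 1)) * Real.log p
      = n * ∑ p ∈ n.primesLE, Real.log p / (p - 1) := by
    rw [Finset.mul_sum]
    refine Finset.sum_congr rfl fun p _ => ?_
    ring
  have h6 : (n : ℝ) * (Real.log n - 1) ≤ n * ∑ p ∈ n.primesLE, Real.log p / (p - 1) := by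
    linarith
  exact le_of_mul_le_mul_left h6 hn0

/-- The two weights differ by `2 log x / (x² - 1)`, and `log x ≤ 2 √x` makes this summable. Passing
from `1 / (p - 1)` to `1 / (1 + p)` in Mertens' theorem therefore costs only a constant. -/
theorem log_div_sub_one_le_log_div_add_one (x : ℝ) (hx : 2 ≤ x) :
    Real.log x / (x - 1) ≤ Real.log x / (x + 1) + 8 * (1 / x ^ (3 / 2 : ℝ)) := by
  have hx0 : 0 < x := by linarith
  have hl : Real.log x ≤ x ^ (1 / 2 : ℝ) / (1 / 2) := Real.log_le_rpow_div hx0.le (by norm_num)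
  have hs : 0 < x ^ (1 / 2 : ℝ) := Real.rpow_pos_of_pos hx0 _
  have h32 : x ^ (3 / 2 : ℝ) = x * x ^ (1 / 2 : ℝ) := by
    rw [← Real.rpow_one_add' hx0.le (by norm_num)]
    norm_num
  have hss : x ^ (1 / 2 : ℝ) * x ^ (1 / 2 : ℝ) = x := by
    rw [← Real.rpow_add hx0]
    norm_num
  have e : Real.log x / (x - 1) - Real.log x / (x + 1) = 2 * Real.log x / ((x - 1) * (x + 1)) := by
    have : x - 1 ≠ 0 := by linarith
    have : x + 1 ≠ 0 := by linarith
    field_simp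
    ring
  have h1 : 2 * Real.log x / ((x - 1) * (x + 1)) ≤ 8 * (1 / x ^ (3 / 2 : ℝ)) := by
    rw [h32, mul_one_div, div_le_div_iff₀ (by nlinarith) (by positivity)]
    have : Real.log x ≤ 2 * x ^ (1 / 2 : ℝ) := by linarith
    calc 2 * Real.log x * (x * x ^ (1 / 2 : ℝ))
        ≤ 2 * (2 * x ^ (1 / 2 : ℝ)) * (x * x ^ (1 / 2 : ℝ)) := by gcongr
      _ = 4 * x * (x ^ (1 / 2 : ℝ) * x ^ (1 / 2 : ℝ)) := by ring
      _ = 4 * x * x := by rw [hss]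
      _ ≤ 8 * ((x - 1) * (x + 1)) := by nlinarith
  linarith

/-- Mertens' first theorem with weights `log p / (1 + p)`. -/
theorem exists_abs_sum_log_div_one_add_prime_sub_log_le :
    ∃ C : ℝ, 0 ≤ C ∧ ∀ n : ℕ, 1 ≤ n →
      |∑ p ∈ n.primesLE, Real.log p / (1 + p) - Real.log n| ≤ C := by
  have hsum : Summable fun n : ℕ => 1 / (n : ℝ) ^ (3 / 2 : ℝ) :=
    Real.summable_one_div_nat_rpow.2 (by norm_num)
  have hT : 0 ≤ ∑' n : ℕ, 1 / (n : ℝ) ^ (3 / 2 : ℝ) := tsum_nonneg fun n => by positivity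
  have h4 : 0 ≤ Real.log 4 := Real.log_nonneg (by norm_num)
  refine ⟨Real.log 4 + 1 + 8 * ∑' n : ℕ, 1 / (n : ℝ) ^ (3 / 2 : ℝ), by positivity, fun n hn => ?_⟩
  rw [abs_le]
  constructor
  · have h1 := le_sum_log_div_prime_sub_one n hn
    have h2 : ∑ p ∈ n.primesLE, Real.log p / ((p : ℝ) - 1) ≤
        ∑ p ∈ n.primesLE, (Real.log p / (1 + (p : ℝ)) + 8 * (1 / (p : ℝ) ^ (3 / 2 : ℝ))) := by
      refine Finset.sum_le_sum fun p hp => ?_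
      rw [add_comm 1 (p : ℝ)]
      exact log_div_sub_one_le_log_div_add_one p
        (by exact_mod_cast Nat.two_le_of_mem_primesLE hp)
    rw [Finset.sum_add_distrib, ← Finset.mul_sum] at h2
    have h3 := hsum.sum_le_tsum n.primesLE (fun i _ => by positivity)
    linarith
  · have h1 := sum_log_div_prime_le n hn
    have h2 : ∑ p ∈ n.primesLE, Real.log p / (1 + (p : ℝ)) ≤
        ∑ p ∈ n.primesLE, Real.log p / (p : ℝ) := by
      refine Finset.sum_le_sum fun p hp => ?_
      have : (0 : ℝ) < p := by exact_mod_cast (Nat.prime_of_mem_primesLE hp).pos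
      exact div_le_div_of_nonneg_left (Real.log_natCast_nonneg p) this (by linarith)
    linarith

/-! ### Equidistribution of the weighted points `log p_j / log p_n` -/

theorem primeSeq_prime (j : ℕ) : (primeSeq j).Prime := Nat.prime_nth_prime _

theorem primeSeq_add_one_strictMono : StrictMono fun j => primeSeq (j + 1) :=
  Nat.nth_strictMono Nat.infinite_setOfPred_prime

theorem sum_range_primeSeq (f : ℕ → ℝ) (n : ℕ) :
    ∑ j ∈ Finset.range (n + 1), f (primeSeq (j + 1))
      = ∑ p ∈ (primeSeq (n + 1)).primesLE, f p := by
  rw [← Finset.sum_image (g := fun j => primeSeq (j + 1)) (f := f)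
    (fun a _ b _ h => primeSeq_add_one_strictMono.injective h)]
  congr 1
  ext p
  simp only [Finset.mem_image, Finset.mem_range, Nat.mem_primesLE]
  constructor
  · rintro ⟨j, hj, rfl⟩
    exact ⟨primeSeq_add_one_strictMono.monotone (by omega), primeSeq_prime _⟩
  · rintro ⟨hp, hpp⟩
    have hc : primeSeq (Nat.count Nat.Prime p + 1) = p := Nat.nth_count hpp
    refine ⟨Nat.count Nat.Prime p, ?_, hc⟩
    rw [← hc] at hp
    have := primeSeq_add_one_strictMono.le_iff_le.1 hp
    omega

theorem add_two_le_primeSeq (n : ℕ) : n + 2 ≤ primeSeq (n + 1) := Nat.add_two_le_nth_prime n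

/-- Comparison of a weighted sum with an integral: the weights `W (j + 1) - W j` sit at the
points `l (j + 1) / L`, and `W` stays within distance `C` of `l`. -/
theorem abs_sum_sub_integral_le {l W : ℕ → ℝ} {n : ℕ} {C D : ℝ} (hl0 : l 0 = 0) (hW0 : W 0 = 0)
    (hl : Monotone l) (hln : 0 < l n) (hC : 0 ≤ C) (hWl : ∀ j, |W j - l j| ≤ C)
    (hD : ∀ j, l (j + 1) - l j ≤ D) {G : ℝ → ℝ} (hG : LipschitzWith 1 G) (hG1 : ∀ x, |G x| ≤ 1) :
    |∑ j ∈ Finset.range n, (W (j + 1) - W j) / l n * G (l (j + 1) / l n)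
        - ∫ u in (0 : ℝ)..1, G u| ≤ (2 * C + D) / l n := by
  have hGl : ∀ x y, |G x - G y| ≤ |x - y| := fun x y => by
    have := hG.dist_le_mul x y
    simpa [Real.dist_eq] using this
  set L := l n with hL
  set a : ℕ → ℝ := fun j => l j / L with ha
  have hamono : ∀ j, a j ≤ a (j + 1) := fun j =>
    div_le_div_of_nonneg_right (hl (Nat.le_succ j)) hln.le
  have ha0 : a 0 = 0 := by simp [ha, hl0]
  have han : a n = 1 := by simp [ha, ← hL, hln.ne']
  have htel : ∑ j ∈ Finset.range n, (a (j + 1) - a j) = 1 := by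
    rw [Finset.sum_range_sub, ha0, han, sub_zero]
  set e : ℕ → ℝ := fun j => W j - l j with he
  -- Summation by parts moves the differences from the error `e` onto `G ∘ a`. The total variation
  -- of `G ∘ a` is at most `a n - a 0 = 1`; together with the boundary term this gives `2 * C`.
  have abel : ∀ m, ∑ j ∈ Finset.range m, (e (j + 1) - e j) * G (a (j + 1))
      = e m * G (a m) - ∑ j ∈ Finset.range m, e j * (G (a (j + 1)) - G (a j)) := by
    intro m
    induction m with
    | zero => simp [he, hl0, hW0]
    | succ m ih => rw [Finset.sum_range_succ, Finset.sum_range_succ, ih]; ring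
  have h1 : |∑ j ∈ Finset.range n, (e (j + 1) - e j) * G (a (j + 1))| ≤ 2 * C := by
    rw [abel]
    refine (abs_sub _ _).trans ?_
    have hA : |e n * G (a n)| ≤ C := by
      rw [abs_mul]
      exact (mul_le_mul (hWl n) (hG1 _) (abs_nonneg _) hC).trans (by simp)
    have hB : |∑ j ∈ Finset.range n, e j * (G (a (j + 1)) - G (a j))| ≤ C := by
      refine (Finset.abs_sum_le_sum_abs _ _).trans ?_
      calc ∑ j ∈ Finset.range n, |e j * (G (a (j + 1)) - G (a j))|
          ≤ ∑ j ∈ Finset.range n, C * (a (j + 1) - a j) := by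
            refine Finset.sum_le_sum fun j _ => ?_
            rw [abs_mul]
            refine mul_le_mul (hWl j) ?_ (abs_nonneg _) hC
            refine (hGl _ _).trans ?_
            rw [abs_of_nonneg (sub_nonneg.2 (hamono j))]
        _ = C := by rw [← Finset.mul_sum, htel, mul_one]
    linarith
  -- What remains is a right-endpoint Riemann sum of mesh at most `D / L` for a 1-Lipschitz
  -- function.
  have h2 : |∑ j ∈ Finset.range n, (a (j + 1) - a j) * G (a (j + 1))
      - ∫ u in (0 : ℝ)..1, G u| ≤ D / L := by
    have hint : ∀ x y, IntervalIntegrable G volume x y := fun x y =>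
      hG.continuous.intervalIntegrable _ _
    have hsplit : ∫ u in (0 : ℝ)..1, G u
        = ∑ j ∈ Finset.range n, ∫ u in a j..a (j + 1), G u := by
      rw [intervalIntegral.sum_integral_adjacent_intervals (fun _ _ => hint _ _), ha0, han]
    rw [hsplit, ← Finset.sum_sub_distrib]
    refine (Finset.abs_sum_le_sum_abs _ _).trans ?_
    calc _ ≤ ∑ j ∈ Finset.range n, D / L * (a (j + 1) - a j) := by
          refine Finset.sum_le_sum fun j _ => ?_
          have e1 : (a (j + 1) - a j) * G (a (j + 1)) - ∫ u in a j..a (j + 1), G u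
              = ∫ u in a j..a (j + 1), (G (a (j + 1)) - G u) := by
            rw [intervalIntegral.integral_sub intervalIntegrable_const (hint _ _)]
            simp
          have hgap : a (j + 1) - a j ≤ D / L := by
            simp only [ha]
            rw [← sub_div]
            exact div_le_div_of_nonneg_right (hD j) hln.le
          rw [e1, ← Real.norm_eq_abs]
          refine (intervalIntegral.norm_integral_le_of_norm_le_const (C := D / L) ?_).trans ?_
          · intro u hu
            rw [Set.uIoc_of_le (hamono j)] at hu
            rw [Real.norm_eq_abs]
            refine (hGl _ _).trans ?_
            rw [abs_of_nonneg (by linarith [hu.2])]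
            linarith [hu.1]
          · rw [abs_of_nonneg (sub_nonneg.2 (hamono j))]
      _ = D / L := by rw [← Finset.mul_sum, htel, mul_one]
  have e2 : ∑ j ∈ Finset.range n, (W (j + 1) - W j) / L * G (a (j + 1))
      = (∑ j ∈ Finset.range n, (e (j + 1) - e j) * G (a (j + 1))) / L
        + ∑ j ∈ Finset.range n, (a (j + 1) - a j) * G (a (j + 1)) := by
    rw [Finset.sum_div, ← Finset.sum_add_distrib]
    refine Finset.sum_congr rfl fun j _ => ?_
    simp only [he, ha]
    ring
  change |∑ j ∈ Finset.range n, (W (j + 1) - W j) / L * G (a (j + 1)) - _| ≤ _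
  rw [e2, add_sub_assoc]
  refine (abs_add_le _ _).trans ?_
  rw [abs_div, abs_of_pos hln, add_div]
  exact add_le_add (div_le_div_of_nonneg_right h1 hln.le) h2

/-- The measure `∑_{j ≤ n} (log p_j / log p_n) / (1 + p_j) δ_{log p_j / log p_n}` is close to the
uniform distribution on `[0, 1]`. -/
theorem exists_abs_sum_primeSeq_sub_integral_le :
    ∃ C : ℝ, 0 ≤ C ∧ ∀ n : ℕ, 1 ≤ n → ∀ G : ℝ → ℝ, LipschitzWith 1 G → (∀ x, |G x| ≤ 1) →
      |∑ j ∈ Finset.range n,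
          Real.log (primeSeq (j + 1)) / Real.log (primeSeq n) * (1 / (1 + (primeSeq (j + 1) : ℝ)))
            * G (Real.log (primeSeq (j + 1)) / Real.log (primeSeq n)) - ∫ u in (0 : ℝ)..1, G u|
        ≤ C / Real.log (primeSeq n) := by
  obtain ⟨C, hC, hM⟩ := exists_abs_sum_log_div_one_add_prime_sub_log_le
  refine ⟨2 * C + (1 + 2 * C), by positivity, fun n hn G hG hG1 => ?_⟩
  -- The value at 0 is imposed: truncated subtraction gives `primeSeq 0 = 2`, whereas the partition
  -- of `[0, 1]` must start at 0.
  set l : ℕ → ℝ := fun j => if j = 0 then 0 else Real.log (primeSeq j) with hl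
  set W : ℕ → ℝ := fun j => ∑ i ∈ Finset.range j,
    Real.log (primeSeq (i + 1)) / (1 + (primeSeq (i + 1) : ℝ)) with hW
  have hls : ∀ j, l (j + 1) = Real.log (primeSeq (j + 1)) := fun j => by simp [hl]
  have hWs : ∀ j, W (j + 1) - W j
      = Real.log (primeSeq (j + 1)) / (1 + (primeSeq (j + 1) : ℝ)) := fun j => by
    simp [hW, Finset.sum_range_succ]
  have hlmono : Monotone l := by
    refine monotone_nat_of_le_succ fun j => ?_
    rcases j with _ | j
    · rw [hls]
      simpa [hl] using Real.log_natCast_nonneg _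
    · rw [hls, hls]
      refine Real.log_le_log (by exact_mod_cast (primeSeq_prime _).pos) ?_
      exact_mod_cast primeSeq_add_one_strictMono.monotone (Nat.le_succ j)
  have hWl : ∀ j, |W j - l j| ≤ C := by
    intro j
    rcases j with _ | j
    · simpa [hW, hl] using hC
    · rw [hls]
      simp only [hW]
      rw [sum_range_primeSeq (fun p => Real.log p / (1 + (p : ℝ)))]
      exact hM _ (primeSeq_prime _).pos
  -- Mertens alone bounds the gaps between consecutive `log p_j`: `W` jumps by at most 1 and stays
  -- within `C` of `l`.
  have hgap : ∀ j, l (j + 1) - l j ≤ 1 + 2 * C := by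
    intro j
    have h1 := abs_le.1 (hWl j)
    have h2 := abs_le.1 (hWl (j + 1))
    have h3 : W (j + 1) - W j ≤ 1 := by
      rw [hWs]
      have hp : (0 : ℝ) < primeSeq (j + 1) := by exact_mod_cast (primeSeq_prime (j + 1)).pos
      rw [div_le_one (by linarith)]
      linarith [Real.log_le_sub_one_of_pos hp]
    linarith [h1.1, h1.2, h2.1, h2.2]
  obtain ⟨m, rfl⟩ : ∃ m, n = m + 1 := ⟨n - 1, by omega⟩
  have hpos : 0 < l (m + 1) := by
    rw [hls]
    exact Real.log_pos (by exact_mod_cast (primeSeq_prime _).one_lt)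
  have key := abs_sum_sub_integral_le (n := m + 1) (by simp [hl]) (by simp [hW]) hlmono hpos hC
    hWl hgap hG hG1
  rw [hls m] at key
  convert key using 4
  rw [hWs, hls]
  ring

/-- From `log p ≤ 4 p^(1/4)` each square is at most `16 p^(-3/2)`, which is summable over all
integers. This controls the error of the approximate size-bias identity. -/
theorem exists_sum_sq_log_div_primeSeq_le :
    ∃ C : ℝ, 0 ≤ C ∧ ∀ n : ℕ, ∑ j ∈ Finset.range n,
      (Real.log (primeSeq (j + 1)) * (1 / (1 + (primeSeq (j + 1) : ℝ)))) ^ 2 ≤ C := by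
  have hsum : Summable fun n : ℕ => 16 * (1 / (n : ℝ) ^ (3 / 2 : ℝ)) :=
    (Real.summable_one_div_nat_rpow.2 (by norm_num)).mul_left _
  refine ⟨∑' n : ℕ, 16 * (1 / (n : ℝ) ^ (3 / 2 : ℝ)), tsum_nonneg fun n => by positivity,
    fun n => ?_⟩
  refine le_trans ?_ (hsum.sum_le_tsum
    ((Finset.range n).image fun j => primeSeq (j + 1)) (fun i _ => by positivity))
  rw [Finset.sum_image (fun a _ b _ h => primeSeq_add_one_strictMono.injective h)]
  refine Finset.sum_le_sum fun j _ => ?_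
  have hx : (0 : ℝ) < primeSeq (j + 1) := by exact_mod_cast (primeSeq_prime (j + 1)).pos
  have hx1 : (1 : ℝ) ≤ primeSeq (j + 1) := by exact_mod_cast (primeSeq_prime (j + 1)).one_le
  set x : ℝ := (primeSeq (j + 1) : ℝ)
  have h1 : Real.log x ≤ x ^ (1 / 4 : ℝ) / (1 / 4) := Real.log_le_rpow_div hx.le (by norm_num)
  have h2 : 0 ≤ Real.log x := Real.log_nonneg hx1
  have h3 : Real.log x * (1 / (1 + x)) ≤ 4 * x ^ (1 / 4 : ℝ) / x := by
    rw [mul_one_div]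
    exact div_le_div₀ (by positivity) (by linarith) hx (by linarith)
  refine (pow_le_pow_left₀ (by positivity) h3 2).trans_eq ?_
  have h4 : (x ^ (1 / 4 : ℝ)) ^ 2 * x ^ (3 / 2 : ℝ) = x ^ 2 := by
    rw [← Real.rpow_natCast, ← Real.rpow_mul hx.le, ← Real.rpow_add hx, ← Real.rpow_natCast]
    norm_num
  have h5 : 0 < x ^ (3 / 2 : ℝ) := Real.rpow_pos_of_pos hx _
  rw [div_pow, mul_pow, mul_one_div, div_eq_div_iff (by positivity) h5.ne', ← h4]
  ring

/-! ### The Stein equation of the Dickman law -/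

open scoped BoundedContinuousFunction in
theorem continuous_integral_mul_comp {g : ℝ → ℝ} (hg : Continuous g) (F : ℝ →ᵇ ℝ) :
    Continuous fun x : ℝ => ∫ u in (0 : ℝ)..1, u * (g (u * x) + F (u * x + 1)) :=
  intervalIntegral.continuous_parametric_intervalIntegral_of_continuous'
    (f := fun x u : ℝ => u * (g (u * x) + F (u * x + 1)))
    (by have := F.continuous; simp only [Function.uncurry_def]; fun_prop) 0 1

/-- The weight has `∫₀¹ u du = 1/2`. This is the contraction factor of `dickmanOperator`, and it
gives the sup bound `(1 + 1) / 2 = 1` on its fixed point. -/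
theorem abs_integral_mul_le {f : ℝ → ℝ} {M : ℝ} (hf : ∀ u ∈ Set.Ioc (0 : ℝ) 1, |f u| ≤ M) :
    |∫ u in (0 : ℝ)..1, u * f u| ≤ M / 2 := by
  have h := intervalIntegral.norm_integral_le_of_norm_le (μ := volume) (a := (0 : ℝ)) (b := 1)
    (f := fun u => u * f u) (g := fun u => u * M) zero_le_one
    (ae_of_all _ fun u hu => by
      rw [Real.norm_eq_abs, abs_mul, abs_of_pos hu.1]
      exact mul_le_mul_of_nonneg_left (hf u hu) hu.1.le)
    (by apply Continuous.intervalIntegrable; fun_prop)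
  rw [intervalIntegral.integral_mul_const, integral_id] at h
  simpa [Real.norm_eq_abs, div_eq_inv_mul] using h

/-- The maps `x ↦ u x` and `x ↦ u x + 1` shrink distances by `u`, so Lipschitz estimates gain a
second factor `u`, and `∫₀¹ u² du = 1/3`. -/
theorem abs_integral_mul_le_of_le_mul {f : ℝ → ℝ} {M : ℝ}
    (hf : ∀ u ∈ Set.Ioc (0 : ℝ) 1, |f u| ≤ u * M) :
    |∫ u in (0 : ℝ)..1, u * f u| ≤ M / 3 := by
  have h := intervalIntegral.norm_integral_le_of_norm_le (μ := volume) (a := (0 : ℝ)) (b := 1)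
    (f := fun u => u * f u) (g := fun u => u ^ 2 * M) zero_le_one
    (ae_of_all _ fun u hu => by
      rw [Real.norm_eq_abs, abs_mul, abs_of_pos hu.1, pow_two, mul_assoc]
      exact mul_le_mul_of_nonneg_left (hf u hu) hu.1.le)
    (by apply Continuous.intervalIntegrable; fun_prop)
  rw [intervalIntegral.integral_mul_const, integral_pow] at h
  norm_num at h
  linarith

open scoped BoundedContinuousFunction in
/-- For bounded continuous `g`, the integral operator
`F ↦ (x ↦ ∫₀¹ u (g (u x) + F (u x + 1)) du)` on bounded continuous functions. -/
noncomputable def dickmanOperator (g : ℝ → ℝ) (hg : Continuous g) (hg1 : ∀ x, |g x| ≤ 1)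
    (F : ℝ →ᵇ ℝ) : ℝ →ᵇ ℝ :=
  BoundedContinuousFunction.ofNormedAddCommGroup
    (fun x : ℝ => ∫ u in (0 : ℝ)..1, u * (g (u * x) + F (u * x + 1)))
    (continuous_integral_mul_comp hg F) ((1 + ‖F‖) / 2)
    (fun _ => abs_integral_mul_le fun _ _ => (abs_add_le _ _).trans
      (add_le_add (hg1 _) (F.norm_coe_le_norm _)))

theorem dickmanOperator_apply {g : ℝ → ℝ} (hg : Continuous g) (hg1 : ∀ x, |g x| ≤ 1)
    (F : BoundedContinuousFunction ℝ ℝ) (x : ℝ) :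
    dickmanOperator g hg hg1 F x = ∫ u in (0 : ℝ)..1, u * (g (u * x) + F (u * x + 1)) := rfl

theorem contractingWith_dickmanOperator {g : ℝ → ℝ} (hg : Continuous g)
    (hg1 : ∀ x, |g x| ≤ 1) : ContractingWith (1 / 2) (dickmanOperator g hg hg1) := by
  refine ⟨by rw [one_div]; exact NNReal.inv_lt_one_iff (by norm_num) |>.2 (by norm_num), ?_⟩
  refine LipschitzWith.of_dist_le_mul fun F H => ?_
  refine (BoundedContinuousFunction.dist_le (by positivity)).2 fun x => ?_
  rw [Real.dist_eq, dickmanOperator_apply, dickmanOperator_apply,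
    ← intervalIntegral.integral_sub]
  · have : ∀ u, u * (g (u * x) + F (u * x + 1)) - u * (g (u * x) + H (u * x + 1))
        = u * (F (u * x + 1) - H (u * x + 1)) := fun u => by ring
    simp only [this]
    refine (abs_integral_mul_le (M := dist F H) fun u _ => ?_).trans ?_
    · rw [← Real.dist_eq]
      exact BoundedContinuousFunction.dist_coe_le_dist _
    · push_cast; linarith
  all_goals
    apply Continuous.intervalIntegrable
    have := F.continuous
    have := H.continuous
    fun_prop

/-- The derivative of the solution of the Dickman Stein equation. -/
theorem exists_integral_fixedPoint {g : ℝ → ℝ} (hg : LipschitzWith 1 g)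
    (hg1 : ∀ x, |g x| ≤ 1) :
    ∃ F : ℝ → ℝ, LipschitzWith 1 F ∧ (∀ x, |F x| ≤ 1) ∧
      ∀ x, F x = ∫ u in (0 : ℝ)..1, u * (g (u * x) + F (u * x + 1)) := by
  have hT := contractingWith_dickmanOperator hg.continuous hg1
  set T := dickmanOperator g hg.continuous hg1 with hTdef
  have hlim := hT.tendsto_iterate_fixedPoint 0
  have hpt : ∀ x, Tendsto (fun n => (T^[n] 0) x) atTop (nhds (ContractingWith.fixedPoint T hT x)) :=
    fun x => ((BoundedContinuousFunction.lipschitz_eval_const x).continuous.tendsto _).comp hlim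
  have hgl : ∀ x y, |g x - g y| ≤ |x - y| := fun x y => by
    simpa [Real.dist_eq] using hg.dist_le_mul x y
  -- Both bounds hold for every iterate started at 0, by `(1 + 1) / 2 = 1` here and `(1 + 1) / 3 ≤
  -- 1` for the Lipschitz constant, and both survive pointwise limits.
  have hbound : ∀ n x, |(T^[n] 0) x| ≤ 1 := by
    intro n
    induction n with
    | zero => simp
    | succ n ih =>
      intro x
      rw [Function.iterate_succ_apply', hTdef, dickmanOperator_apply]
      refine (abs_integral_mul_le (M := 2) fun u _ => ?_).trans (by norm_num)
      refine (abs_add_le _ _).trans ?_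
      have := hg1 (u * x)
      have := ih (u * x + 1)
      linarith
  have hlip : ∀ n x y, |(T^[n] 0) x - (T^[n] 0) y| ≤ |x - y| := by
    intro n
    induction n with
    | zero => simp
    | succ n ih =>
      intro x y
      rw [Function.iterate_succ_apply', hTdef, dickmanOperator_apply, dickmanOperator_apply,
        ← intervalIntegral.integral_sub]
      · rw [← hTdef]
        simp only [← mul_sub]
        refine (abs_integral_mul_le_of_le_mul (M := 2 * |x - y|) fun u hu => ?_).trans
          (by linarith [abs_nonneg (x - y)])
        have h1 := hgl (u * x) (u * y)
        have h2 := ih (u * x + 1) (u * y + 1)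
        have e1 : |u * x - u * y| = u * |x - y| := by
          rw [← mul_sub, abs_mul, abs_of_pos hu.1]
        have e2 : |u * x + 1 - (u * y + 1)| = u * |x - y| := by
          rw [← e1]; congr 1; ring
        rw [add_sub_add_comm]
        refine (abs_add_le _ _).trans ?_
        rw [e1] at h1
        rw [e2] at h2
        linarith
      all_goals
        apply Continuous.intervalIntegrable
        have := (T^[n] 0).continuous
        have := hg.continuous
        rw [← hTdef]
        fun_prop
  refine ⟨⇑(ContractingWith.fixedPoint T hT), ?_, fun x => ?_, fun x => ?_⟩
  · refine LipschitzWith.of_dist_le_mul fun x y => ?_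
    rw [NNReal.coe_one, one_mul, Real.dist_eq, Real.dist_eq]
    exact le_of_tendsto ((hpt x).sub (hpt y)).abs (Eventually.of_forall fun n => hlip n x y)
  · exact le_of_tendsto (hpt x).abs (Eventually.of_forall fun n => hbound n x)
  · conv_lhs => rw [← hT.fixedPoint_isFixedPt]
    rfl

/-- The Stein equation of the Dickman distribution. -/
theorem exists_dickman_stein_solution {h : ℝ → ℝ} (hh : Differentiable ℝ h)
    (hlip : LipschitzWith 1 (deriv h)) (hb : ∀ x, |deriv h x| ≤ 1) :
    ∃ F : ℝ → ℝ, LipschitzWith 1 F ∧ (∀ x, |F x| ≤ 1) ∧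
      ∃ c : ℝ, ∀ x, x * F x - ∫ u in (0 : ℝ)..1, F (x + u) = h x - c := by
  obtain ⟨F, hFl, hFb, hF⟩ := exists_integral_fixedPoint hlip hb
  refine ⟨F, hFl, hFb, ?_⟩
  have hFc := hFl.continuous
  have hgc := hlip.continuous
  set g := deriv h with hg
  have hHc : Continuous fun v => v * (g v + F (v + 1)) := by fun_prop
  have hint : ∀ f : ℝ → ℝ, Continuous f → ∀ a b, IntervalIntegrable f volume a b :=
    fun f hf a b => hf.intervalIntegrable a b
  -- Differentiating the Stein equation and multiplying by `x` gives `(x² F)' = x (h'(x) + F(x +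
  -- 1))`. The fixed-point equation is the integral of this from 0, after substituting `v = u x`.
  have hsq : ∀ x, x ^ 2 * F x = ∫ v in (0 : ℝ)..x, v * (g v + F (v + 1)) := by
    intro x
    have h1 := intervalIntegral.mul_integral_comp_mul_right (a := 0) (b := 1)
      (f := fun v => v * (g v + F (v + 1))) x
    rw [zero_mul, one_mul] at h1
    rw [← h1, hF x, pow_two, mul_assoc, ← intervalIntegral.integral_const_mul]
    congr 2
    ext u
    ring
  have hshift : ∀ x, ∫ u in (0 : ℝ)..1, F (x + u)
      = (∫ u in (0 : ℝ)..(x + 1), F u) - ∫ u in (0 : ℝ)..x, F u := by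
    intro x
    rw [intervalIntegral.integral_comp_add_left, add_zero,
      intervalIntegral.integral_interval_sub_left (hint F hFc _ _) (hint F hFc _ _)]
  have hder : ∀ x, HasDerivAt (fun x => x ^ 2 * F x) (x * (g x + F (x + 1))) x := by
    intro x
    have : (fun x => x ^ 2 * F x) = fun x => ∫ v in (0 : ℝ)..x, v * (g v + F (v + 1)) :=
      funext hsq
    rw [this]
    exact intervalIntegral.integral_hasDerivAt_right (hint _ hHc _ _)
      (hHc.stronglyMeasurableAtFilter _ _) hHc.continuousAt
  have hprim : ∀ x, HasDerivAt (fun x => ∫ u in (0 : ℝ)..x, F u) (F x) x := fun x =>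
    intervalIntegral.integral_hasDerivAt_right (hint _ hFc _ _)
      (hFc.stronglyMeasurableAtFilter _ _) hFc.continuousAt
  set K : ℝ → ℝ := fun x => x * F x
    - ((∫ u in (0 : ℝ)..(x + 1), F u) - ∫ u in (0 : ℝ)..x, F u) - h x with hK
  have hKc : Continuous K := by
    have h1 : Continuous fun x => ∫ u in (0 : ℝ)..x, F u :=
      continuous_iff_continuousAt.2 fun x => (hprim x).continuousAt
    have h2 : Continuous fun x : ℝ => ∫ u in (0 : ℝ)..(x + 1), F u :=
      h1.comp (continuous_id.add continuous_const)
    exact ((continuous_id.mul hFc).sub (h2.sub h1)).sub hh.continuous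
  -- Away from 0, `x F(x)` is differentiable as the quotient of `x² F(x)` by `x`. At 0 the
  -- continuity of `K` suffices for it to be constant.
  have hKd : ∀ x, x ≠ 0 → HasDerivAt K 0 x := by
    intro x hx
    have h1 : HasDerivAt (fun x => x * F x) (g x + F (x + 1) - F x) x := by
      have h0 := (hder x).div (hasDerivAt_id x) hx
      have h3 : HasDerivAt (fun y => y ^ 2 * F y / id y) (g x + F (x + 1) - F x) x := by
        refine HasDerivAt.congr_deriv h0 ?_
        simp only [id_eq]
        field_simp
      refine h3.congr_of_eventuallyEq ?_
      filter_upwards [isOpen_ne.mem_nhds hx] with y hy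
      have : y ≠ 0 := hy
      simp only [id]
      field_simp
    have h2 : HasDerivAt (fun x : ℝ => ∫ u in (0 : ℝ)..(x + 1), F u) (F (x + 1)) x :=
      HasDerivAt.comp_add_const x 1 (hprim (x + 1))
    have h4 := (h1.sub (h2.sub (hprim x))).sub (hh x).hasDerivAt
    exact h4.congr_deriv (by ring)
  have hconst : ∀ x, K x = K 0 := by
    intro x
    have := integral_eq_of_hasDerivAt_off_countable K (fun _ => 0) (a := 0) (b := x)
      (Set.countable_singleton 0) hKc.continuousOn
      (fun y hy => hKd y fun h0 => hy.2 (by simpa using h0)) (by simp)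
    simp at this
    linarith
  refine ⟨-K 0, fun x => ?_⟩
  rw [hshift]
  have := hconst x
  simp only [hK] at this ⊢
  linarith

/-- The bound on `h''` makes `h'` 1-Lipschitz. -/
theorem exists_dickman_stein_solution_of_mem {h : ℝ → ℝ} (hh : h ∈ smoothTestFunctions 3) :
    ∃ F : ℝ → ℝ, LipschitzWith 1 F ∧ (∀ x, |F x| ≤ 1) ∧
      ∃ c : ℝ, ∀ x, x * F x - ∫ u in (0 : ℝ)..1, F (x + u) = h x - c := by
  obtain ⟨hC, hb⟩ := hh
  have hC3 : ContDiff ℝ (2 + 1) h := by exact_mod_cast hC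
  have hd := (contDiff_succ_iff_deriv.1 hC3)
  refine exists_dickman_stein_solution hd.1 ?_ fun x => ?_
  · refine lipschitzWith_of_nnnorm_deriv_le (hd.2.2.differentiable (by norm_num)) fun x => ?_
    have := hb 2 (by norm_num) x
    rw [iteratedDeriv_succ, iteratedDeriv_one] at this
    rw [← NNReal.coe_le_coe]
    simpa using this
  · simpa [iteratedDeriv_one] using hb 1 (by norm_num) x

/-! ### Moments and size bias of the Dickman law -/

/-- The characteristic exponent of the Dickman distribution. -/
noncomputable def dickmanExponent (t : ℝ) : ℂ :=
  ∫ x in (0 : ℝ)..1, (Complex.exp (Complex.I * t * x) - 1) / (x : ℂ)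

theorem norm_exp_I_mul_sub_one_div_le (t x : ℝ) :
    ‖(Complex.exp (Complex.I * t * x) - 1) / (x : ℂ)‖ ≤ |t| := by
  rcases eq_or_ne x 0 with rfl | hx
  · simp
  rw [norm_div, Complex.norm_real, Real.norm_eq_abs, div_le_iff₀ (abs_pos.2 hx), ← abs_mul]
  have := Real.norm_exp_I_mul_ofReal_sub_one_le (x := t * x)
  push_cast at this
  rwa [← mul_assoc] at this

theorem measurable_exp_I_mul_sub_one_div (t : ℝ) :
    Measurable fun x : ℝ => (Complex.exp (Complex.I * t * x) - 1) / (x : ℂ) := by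
  fun_prop

theorem intervalIntegrable_exp_I_mul_sub_one_div (t a b : ℝ) :
    IntervalIntegrable (fun x : ℝ => (Complex.exp (Complex.I * t * x) - 1) / (x : ℂ))
      volume a b := by
  refine (intervalIntegrable_const (c := |t|)).mono_fun
    (measurable_exp_I_mul_sub_one_div t).aestronglyMeasurable (ae_of_all _ fun x => ?_)
  simpa using norm_exp_I_mul_sub_one_div_le t x

theorem norm_dickmanExponent_le (t : ℝ) : ‖dickmanExponent t‖ ≤ |t| := by
  have := intervalIntegral.norm_integral_le_of_norm_le_const (a := (0 : ℝ)) (b := 1)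
    (fun x _ => norm_exp_I_mul_sub_one_div_le t x)
  simpa [dickmanExponent] using this

/-- Differentiating in `t` cancels the singular factor `1 / x` and leaves an integrand of modulus 1,
which allows dominated differentiation. -/
theorem hasDerivAt_dickmanExponent (t : ℝ) :
    HasDerivAt dickmanExponent
      (∫ x in (0 : ℝ)..1, Complex.I * Complex.exp (Complex.I * t * x)) t := by
  refine (intervalIntegral.hasDerivAt_integral_of_dominated_loc_of_deriv_le
    (F := fun (t : ℝ) (x : ℝ) => (Complex.exp (Complex.I * t * x) - 1) / (x : ℂ))
    (F' := fun (t : ℝ) (x : ℝ) => Complex.I * Complex.exp (Complex.I * t * x))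
    (bound := fun _ => 1) (s := Set.univ) univ_mem
    (Eventually.of_forall fun s => (measurable_exp_I_mul_sub_one_div s).aestronglyMeasurable)
    (intervalIntegrable_exp_I_mul_sub_one_div t 0 1)
    (by apply Continuous.aestronglyMeasurable; fun_prop)
    (ae_of_all _ fun x _ s _ => ?_) intervalIntegrable_const
    (ae_of_all _ fun x hx s _ => ?_)).2
  · rw [norm_mul, Complex.norm_I, one_mul]
    have : Complex.I * s * x = Complex.I * ((s * x : ℝ) : ℂ) := by push_cast; ring
    rw [this, mul_comm, Complex.norm_exp_ofReal_mul_I]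
  · rw [Set.uIoc_of_le zero_le_one] at hx
    have hx0 : (x : ℂ) ≠ 0 := by exact_mod_cast hx.1.ne'
    have h1 : HasDerivAt (fun s : ℝ => Complex.I * (s : ℂ) * x) (Complex.I * x) s := by
      simpa using ((Complex.ofRealCLM.hasDerivAt (x := s)).const_mul Complex.I).mul_const (x : ℂ)
    refine ((h1.cexp.sub_const 1).div_const (x : ℂ)).congr_deriv ?_
    field_simp

/-- Although the exponent is only `O(|t|)`, its real part is quadratic because `1 - cos (t x) ≤ (t
x)² / 2`. This is the order needed for a finite second moment. -/
theorem abs_re_dickmanExponent_le (t : ℝ) : |(dickmanExponent t).re| ≤ t ^ 2 := by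
  have h1 : (dickmanExponent t).re
      = ∫ x in (0 : ℝ)..1, ((Complex.exp (Complex.I * t * x) - 1) / (x : ℂ)).re := by
    exact (Complex.reCLM.intervalIntegral_comp_comm
      (intervalIntegrable_exp_I_mul_sub_one_div t 0 1)).symm
  rw [h1, ← Real.norm_eq_abs]
  have h2 := intervalIntegral.norm_integral_le_of_norm_le_const (a := (0 : ℝ)) (b := 1)
    (f := fun x => ((Complex.exp (Complex.I * t * x) - 1) / (x : ℂ)).re) (C := t ^ 2) ?_
  · simpa using h2
  intro x hx
  rw [Set.uIoc_of_le zero_le_one] at hx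
  have e : Complex.I * t * x = ((t * x : ℝ) : ℂ) * Complex.I := by push_cast; ring
  rw [e, Complex.div_ofReal_re, Complex.sub_re, Complex.exp_ofReal_mul_I_re, Complex.one_re,
    Real.norm_eq_abs, abs_div, abs_of_pos hx.1, div_le_iff₀ hx.1,
    abs_of_nonpos (by linarith [Real.cos_le_one (t * x)])]
  have h3 := Real.one_sub_sq_div_two_le_cos (x := t * x)
  have h4 : (t * x) ^ 2 ≤ t ^ 2 * x := by
    rw [mul_pow, pow_two x]
    exact mul_le_mul_of_nonneg_left (by nlinarith [hx.1, hx.2]) (sq_nonneg t)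
  nlinarith [sq_nonneg (t * x)]

section Moments

variable {μ : Measure ℝ}

theorem IsDickman.charFun_eq_exp (hμ : IsDickman 1 μ) (t : ℝ) :
    charFun μ t = Complex.exp (dickmanExponent t) := by
  rw [hμ.charFun_eq t, dickmanExponent]
  simp

theorem IsDickman.one_sub_re_charFun_le (hμ : IsDickman 1 μ) {t : ℝ} (ht : |t| ≤ 1) :
    1 - (charFun μ t).re ≤ 2 * t ^ 2 := by
  rw [hμ.charFun_eq_exp]
  have h1 := norm_dickmanExponent_le t
  have h2 := Complex.norm_exp_sub_one_sub_id_le (h1.trans ht)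
  have h3 := (Complex.abs_re_le_norm _).trans h2
  have h4 : ‖dickmanExponent t‖ ^ 2 ≤ t ^ 2 := by
    rw [← sq_abs t]
    exact pow_le_pow_left₀ (norm_nonneg _) h1 2
  simp only [Complex.sub_re, Complex.one_re] at h3
  have h5 := (abs_le.1 (h3.trans h4)).1
  have h6 := (abs_le.1 (abs_re_dickmanExponent_le t)).1
  linarith

theorem re_charFun_eq_integral_cos [IsFiniteMeasure μ] (t : ℝ) :
    (charFun μ t).re = ∫ x, Real.cos (t * x) ∂μ := by
  rw [charFun_apply_real]
  have hi : Integrable (fun x : ℝ => Complex.exp (t * x * Complex.I)) μ := by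
    refine (integrable_const (1 : ℝ)).mono' (by apply Continuous.aestronglyMeasurable; fun_prop)
      (ae_of_all _ fun x => ?_)
    have := Complex.norm_exp_ofReal_mul_I (t * x)
    push_cast at this
    exact this.le
  have := (Complex.reCLM.integral_comp_comm hi).symm
  refine this.trans (integral_congr_ae (ae_of_all _ fun x => ?_))
  have := Complex.exp_ofReal_mul_I_re (t * x)
  push_cast at this
  exact this

/-- Since `1 - cos y ≥ 2 y² / π²` for `|y| ≤ π`, taking `t = 1 / (K + 1)` bounds `x²` on `[-(K + 1),
K + 1]` by a multiple of `(1 - cos (t x)) / t²`. Its integral is bounded uniformly in `K`. -/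
theorem memLp_two_of_one_sub_re_charFun_le [IsProbabilityMeasure μ] {A : ℝ}
    (hA : ∀ t : ℝ, |t| ≤ 1 → 1 - (charFun μ t).re ≤ A * t ^ 2) : MemLp id 2 μ := by
  rw [memLp_two_iff_integrable_sq measurable_id.aestronglyMeasurable]
  have hcover : AECover μ atTop fun K : ℕ => Set.Icc (-((K : ℝ) + 1)) ((K : ℝ) + 1) :=
    aecover_Icc (tendsto_neg_atTop_atBot.comp
      (tendsto_atTop_add_const_right _ _ tendsto_natCast_atTop_atTop))
      (tendsto_atTop_add_const_right _ _ tendsto_natCast_atTop_atTop)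
  refine hcover.integrable_of_integral_norm_bounded (Real.pi ^ 2 / 2 * A) (fun K => ?_)
    (Eventually.of_forall fun K => ?_)
  · exact (by fun_prop : Continuous fun x : ℝ => id x ^ 2).continuousOn.integrableOn_Icc
  · have hK : (0 : ℝ) < (K : ℝ) + 1 := by positivity
    set t : ℝ := 1 / ((K : ℝ) + 1) with ht
    have htpos : 0 < t := by positivity
    have ht1 : |t| ≤ 1 := by
      rw [abs_of_pos htpos, ht, div_le_one hK]
      linarith [(Nat.cast_nonneg K : (0 : ℝ) ≤ K)]
    have hcosi : Integrable (fun x => 1 - Real.cos (t * x)) μ := by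
      refine (integrable_const (2 : ℝ)).mono' (by apply Continuous.aestronglyMeasurable; fun_prop)
        (ae_of_all _ fun x => ?_)
      rw [Real.norm_eq_abs, abs_le]
      constructor <;> linarith [Real.cos_le_one (t * x), Real.neg_one_le_cos (t * x)]
    have hint : ∫ x, (1 - Real.cos (t * x)) ∂μ ≤ A * t ^ 2 := by
      have hc : Integrable (fun x => Real.cos (t * x)) μ := by
        have := (integrable_const (1 : ℝ)).sub hcosi
        refine this.congr (ae_of_all _ fun x => ?_)
        simp
      rw [integral_sub (integrable_const _) hc, ← re_charFun_eq_integral_cos]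
      simpa using hA t ht1
    have hpi := Real.pi_pos
    have hpt : ∀ x ∈ Set.Icc (-((K : ℝ) + 1)) ((K : ℝ) + 1),
        ‖id x ^ 2‖ ≤ Real.pi ^ 2 / 2 / t ^ 2 * (1 - Real.cos (t * x)) := by
      intro x hx
      have h1 : |t * x| ≤ Real.pi := by
        rw [abs_mul, abs_of_pos htpos, ht, one_div, inv_mul_le_iff₀ hK]
        have : |x| ≤ (K : ℝ) + 1 := abs_le.2 hx
        nlinarith [Real.pi_gt_three]
      have h2 := Real.cos_le_one_sub_mul_cos_sq h1
      have h3 : 2 / Real.pi ^ 2 * (t * x) ^ 2 ≤ 1 - Real.cos (t * x) := by linarith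
      have h4 : Real.pi ^ 2 / 2 / t ^ 2 * (2 / Real.pi ^ 2 * (t * x) ^ 2) = x ^ 2 := by
        field_simp
      rw [id_eq, Real.norm_eq_abs, abs_of_nonneg (sq_nonneg x), ← h4]
      exact mul_le_mul_of_nonneg_left h3 (by positivity)
    calc ∫ x in Set.Icc (-((K : ℝ) + 1)) ((K : ℝ) + 1), ‖id x ^ 2‖ ∂μ
        ≤ ∫ x in Set.Icc (-((K : ℝ) + 1)) ((K : ℝ) + 1),
            Real.pi ^ 2 / 2 / t ^ 2 * (1 - Real.cos (t * x)) ∂μ := by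
          refine setIntegral_mono_on ?_ (hcosi.const_mul _).integrableOn measurableSet_Icc hpt
          exact (by fun_prop : Continuous fun x : ℝ => ‖id x ^ 2‖).continuousOn.integrableOn_Icc
      _ ≤ ∫ x, Real.pi ^ 2 / 2 / t ^ 2 * (1 - Real.cos (t * x)) ∂μ := by
          refine setIntegral_le_integral (hcosi.const_mul _) (ae_of_all _ fun x => ?_)
          have := Real.cos_le_one (t * x)
          exact mul_nonneg (by positivity) (by simpa using this)
      _ ≤ Real.pi ^ 2 / 2 / t ^ 2 * (A * t ^ 2) := by
          rw [integral_const_mul]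
          exact mul_le_mul_of_nonneg_left hint (by positivity)
      _ = Real.pi ^ 2 / 2 * A := by field_simp

theorem IsDickman.memLp_one (hμ : IsDickman 1 μ) : MemLp id 1 μ := by
  have := hμ.isProbabilityMeasure
  exact (memLp_two_of_one_sub_re_charFun_le fun t ht => hμ.one_sub_re_charFun_le ht).mono_exponent
    (by norm_num)

/-- Multiplied by `i`, both sides are the derivative of `charFun μ` at `t`: one from the finite
first moment, the other from the exponential formula. -/
theorem IsDickman.integral_mul_exp (hμ : IsDickman 1 μ) (t : ℝ) :
    ∫ x : ℝ, (x : ℂ) * Complex.exp (t * x * Complex.I) ∂μ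
      = charFun μ t * ∫ x in (0 : ℝ)..1, Complex.exp (t * x * Complex.I) := by
  have := hμ.isProbabilityMeasure
  have h1 := iteratedDeriv_charFun (μ := μ) (n := 1) (t := t) (by exact_mod_cast hμ.memLp_one)
  have h2 : charFun μ = fun t => Complex.exp (dickmanExponent t) := funext hμ.charFun_eq_exp
  rw [iteratedDeriv_one, h2, (hasDerivAt_dickmanExponent t).cexp.deriv,
    intervalIntegral.integral_const_mul] at h1
  simp only [pow_one] at h1
  have h3 : ∀ x : ℝ, Complex.I * t * x = t * x * Complex.I := fun x => by ring
  simp only [h3] at h1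
  rw [h2]
  refine mul_left_cancel₀ Complex.I_ne_zero ?_
  rw [← h1]
  ring

/-- The size-bias identity of the Dickman distribution. -/
theorem IsDickman.integral_mul_eq (hμ : IsDickman 1 μ) {f : ℝ → ℝ} (hf : Continuous f) {M : ℝ}
    (hM : ∀ x, |f x| ≤ M) :
    ∫ x, x * f x ∂μ = ∫ x, (∫ u in (0 : ℝ)..1, f (x + u)) ∂μ := by
  have := hμ.isProbabilityMeasure
  have hid : Integrable (fun x : ℝ => x) μ := memLp_one_iff_integrable.1 hμ.memLp_one
  set U : Measure ℝ := volume.restrict (Set.Ioc 0 1) with hU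
  have hUfin : IsFiniteMeasure U := ⟨by simp [hU]⟩
  -- The law is not yet known to live on `[0, ∞)`, so `x dμ` is split into its positive and negative
  -- parts, two finite measures to which uniqueness of characteristic functions applies.
  set ρ : Measure ℝ := μ.withDensity fun x => ENNReal.ofReal x with hρ
  set σ : Measure ℝ := μ.withDensity fun x => ENNReal.ofReal (-x) with hσ
  have hρfin : IsFiniteMeasure ρ := isFiniteMeasure_withDensity_ofReal hid.2
  have hσfin : IsFiniteMeasure σ := isFiniteMeasure_withDensity_ofReal hid.neg.2
  have hρi : ∀ {E : Type} [NormedAddCommGroup E] [NormedSpace ℝ E] (φ : ℝ → E),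
      ∫ x, φ x ∂ρ = ∫ x, (max x 0) • φ x ∂μ := fun φ => by
    rw [hρ, integral_withDensity_eq_integral_toReal_smul (by fun_prop) (by simp)]
    simp only [ENNReal.toReal_ofReal']
  have hσi : ∀ {E : Type} [NormedAddCommGroup E] [NormedSpace ℝ E] (φ : ℝ → E),
      ∫ x, φ x ∂σ = ∫ x, (max (-x) 0) • φ x ∂μ := fun φ => by
    rw [hσ, integral_withDensity_eq_integral_toReal_smul (by fun_prop) (by simp)]
    simp only [ENNReal.toReal_ofReal']
  have hdiff : ∀ {E : Type} [NormedAddCommGroup E] [NormedSpace ℝ E] (φ : ℝ → E) (M : ℝ),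
      Continuous φ → (∀ x, ‖φ x‖ ≤ M) →
      ∫ x, φ x ∂ρ - ∫ x, φ x ∂σ = ∫ x, x • φ x ∂μ := fun φ M hφ hφM => by
    rw [hρi, hσi, ← integral_sub]
    · congr 1
      ext x
      rw [← sub_smul]
      congr 1
      rcases le_total 0 x with h | h
      · rw [max_eq_left h, max_eq_right (by linarith), sub_zero]
      · rw [max_eq_right h, max_eq_left (by linarith)]; ring
    · exact hid.pos_part.smul_bdd M hφ.aestronglyMeasurable (ae_of_all _ hφM)
    · exact hid.neg_part.smul_bdd M hφ.aestronglyMeasurable (ae_of_all _ hφM)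
  -- This is the size-bias identity `x dμ = d(μ * U)`, with the negative part moved across so that
  -- both sides are finite positive measures.
  have hmeas : (μ.conv U) + σ = ρ := by
    refine Measure.ext_of_charFun (funext fun t => ?_)
    have hb : ∀ x : ℝ, ‖Complex.exp (t * x * Complex.I)‖ ≤ 1 := fun x => by
      have := Complex.norm_exp_ofReal_mul_I (t * x)
      push_cast at this
      exact this.le
    have hc : Continuous fun x : ℝ => Complex.exp (t * x * Complex.I) := by fun_prop
    have hexpi : ∀ (m : Measure ℝ) [IsFiniteMeasure m],
        Integrable (fun x : ℝ => Complex.exp (t * x * Complex.I)) m := fun m _ =>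
      (integrable_const (1 : ℝ)).mono' hc.aestronglyMeasurable (ae_of_all _ hb)
    have h1 : charFun (μ.conv U + σ) t = charFun (μ.conv U) t + charFun σ t := by
      simp only [charFun_apply_real]
      exact integral_add_measure (hexpi _) (hexpi _)
    have h2 := hdiff (fun x : ℝ => Complex.exp (t * x * Complex.I)) 1 hc hb
    rw [← charFun_apply_real, ← charFun_apply_real] at h2
    have h3 := hμ.integral_mul_exp t
    have h4 : charFun U t = ∫ x in (0 : ℝ)..1, Complex.exp (t * x * Complex.I) := by
      rw [charFun_apply_real, intervalIntegral.integral_of_le zero_le_one]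
    simp only [Complex.real_smul] at h2
    rw [h1, charFun_conv, h4, ← h3, ← h2]
    ring
  have hfi : ∀ (m : Measure ℝ) [IsFiniteMeasure m], Integrable f m := fun m _ =>
    (integrable_const M).mono' hf.aestronglyMeasurable (ae_of_all _ hM)
  have h1 := hdiff f M hf hM
  rw [← hmeas, integral_add_measure (hfi _) (hfi _), add_sub_cancel_right,
    integral_conv (hfi _)] at h1
  simp only [smul_eq_mul] at h1
  rw [← h1]
  simp only [intervalIntegral.integral_of_le zero_le_one, hU]

end Moments

/-! ### Approximate size bias for sums of independent variables -/

theorem primeSum_eq_sum_range {Ω : Type*} (X : ℕ → Ω → ℝ) (n : ℕ) (ω : Ω) :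
    primeSum X n ω = ∑ i ∈ Finset.range n,
      Real.log (primeSeq (i + 1)) / Real.log (primeSeq n) * X (i + 1) ω := by
  have hIcc : Finset.Icc 1 n = Finset.Ico (0 + 1) (n + 1) := rfl
  rw [primeSum, hIcc, ← Finset.sum_Ico_add', ← Finset.range_eq_Ico, Finset.mul_sum]
  refine Finset.sum_congr rfl fun i _ => ?_
  ring

theorem IsPrimeBernoulliSeq.measurable_primeSum {Ω : Type*} [MeasurableSpace Ω] {P : Measure Ω}
    {X : ℕ → Ω → ℝ} (hX : IsPrimeBernoulliSeq P X)
    (n : ℕ) : Measurable (primeSum X n) := by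
  have : primeSum X n = fun ω => ∑ i ∈ Finset.range n,
      Real.log (primeSeq (i + 1)) / Real.log (primeSeq n) * X (i + 1) ω :=
    funext (primeSum_eq_sum_range X n)
  rw [this]
  exact Finset.measurable_fun_sum _ fun i _ => (hX.measurable _ (by omega)).const_mul _

section SumsOfIndependent

variable {Ω : Type*} [MeasurableSpace Ω] {P : Measure Ω} [IsProbabilityMeasure P]

/-- Approximate size-bias identity for a sum of independent two-valued variables. -/
theorem abs_integral_sum_mul_comp_sub_le {Y : ℕ → Ω → ℝ} {a q : ℕ → ℝ} (n : ℕ)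
    (hYm : ∀ i, Measurable (Y i)) (hY : iIndepFun Y P) (ha : ∀ i, 0 ≤ a i)
    (hYa : ∀ i, ∀ᵐ ω ∂P, Y i ω = 0 ∨ Y i ω = a i) (hYq : ∀ i, ∫ ω, Y i ω ∂P = a i * q i)
    {F : ℝ → ℝ} (hF : LipschitzWith 1 F) (hF1 : ∀ x, |F x| ≤ 1) :
    |∫ ω, (∑ i ∈ Finset.range n, Y i ω) * F (∑ i ∈ Finset.range n, Y i ω) ∂P
      - ∑ i ∈ Finset.range n, a i * q i * ∫ ω, F (∑ k ∈ Finset.range n, Y k ω + a i) ∂P|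
      ≤ ∑ i ∈ Finset.range n, (a i * q i) ^ 2 := by
  set S : Ω → ℝ := fun ω => ∑ i ∈ Finset.range n, Y i ω with hS
  have hSm : Measurable S := Finset.measurable_fun_sum _ fun i _ => hYm i
  have hFc := hF.continuous
  have hFm := hFc.measurable
  have hY0 : ∀ i, 0 ≤ᵐ[P] Y i := fun i => by
    filter_upwards [hYa i] with ω hω
    rcases hω with h | h <;> simp [h, ha]
  have hYi : ∀ i, Integrable (Y i) P := fun i =>
    (integrable_const (a i)).mono' (hYm i).aestronglyMeasurable (by
      filter_upwards [hYa i] with ω hω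
      rcases hω with h | h <;> simp [h, ha, abs_of_nonneg])
  have haq : ∀ i, 0 ≤ a i * q i := fun i => by
    rw [← hYq]
    exact integral_nonneg_of_ae (hY0 i)
  have hFi : ∀ V : Ω → ℝ, Measurable V → Integrable (fun ω => F (V ω)) P := fun V hV =>
    (integrable_const (1 : ℝ)).mono' (hFm.comp hV).aestronglyMeasurable
      (ae_of_all _ fun ω => hF1 _)
  have hYFi : ∀ i (V : Ω → ℝ), Measurable V → Integrable (fun ω => Y i ω * F (V ω)) P :=
    fun i V hV => (hYi i).mul_bdd (c := 1) (hFm.comp hV).aestronglyMeasurable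
      (ae_of_all _ fun ω => hF1 _)
  have hterm : ∀ i ∈ Finset.range n,
      |∫ ω, Y i ω * F (S ω) ∂P - a i * q i * ∫ ω, F (S ω + a i) ∂P| ≤ (a i * q i) ^ 2 := by
    intro i hi
    -- With the `i`-th term left out, `T` is independent of `Y i`, so `E[Y_i F(S)] = a_i q_i E[F(T +
    -- a_i)]` exactly. Putting `S` back in place of `T` costs at most `E[Y_i] = a_i q_i`, as `F` is
    -- 1-Lipschitz.
    set T : Ω → ℝ := ∑ k ∈ (Finset.range n).erase i, Y k with hT
    have hTm : Measurable T := by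
      rw [hT, Finset.sum_fn]
      exact Finset.measurable_fun_sum _ fun k _ => hYm k
    have hST : ∀ ω, S ω = T ω + Y i ω := fun ω => by
      simp only [hS, hT, Finset.sum_apply]
      rw [Finset.sum_erase_add _ _ hi]
    have hind : IndepFun (Y i) T P :=
      (hY.indepFun_finsetSum_of_notMem hYm (Finset.notMem_erase i _)).symm
    have h1 : ∫ ω, Y i ω * F (S ω) ∂P = a i * q i * ∫ ω, F (T ω + a i) ∂P := by
      rw [← hYq i, ← hind.integral_fun_comp_mul_comp (f := fun y => y)
        (g := fun y => F (y + a i)) (hYm i).aemeasurable hTm.aemeasurable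
        measurable_id.aestronglyMeasurable
        (by apply Continuous.aestronglyMeasurable; fun_prop)]
      refine integral_congr_ae ?_
      filter_upwards [hYa i] with ω hω
      rcases hω with h | h
      · simp [h]
      · simp only [hST, h]
    rw [h1, ← mul_sub, abs_mul, abs_of_nonneg (haq i), pow_two]
    refine mul_le_mul_of_nonneg_left ?_ (haq i)
    rw [← integral_sub (hFi _ (hTm.add_const _)) (hFi _ (hSm.add_const _)), ← hYq i,
      ← Real.norm_eq_abs]
    refine norm_integral_le_of_norm_le (hYi i) ?_
    filter_upwards [hY0 i] with ω hω
    have h2 := hF.dist_le_mul (T ω + a i) (S ω + a i)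
    have h3 : T ω + a i - (S ω + a i) = -Y i ω := by rw [hST]; ring
    rw [Real.dist_eq, Real.dist_eq, h3, abs_neg, abs_of_nonneg hω] at h2
    simpa using h2
  have hsum : ∫ ω, S ω * F (S ω) ∂P = ∑ i ∈ Finset.range n, ∫ ω, Y i ω * F (S ω) ∂P := by
    rw [← integral_finsetSum _ fun i _ => hYFi i S hSm]
    simp only [hS, Finset.sum_mul]
  change |∫ ω, S ω * F (S ω) ∂P - ∑ i ∈ Finset.range n, a i * q i * ∫ ω, F (S ω + a i) ∂P| ≤ _
  rw [hsum, ← Finset.sum_sub_distrib]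
  exact (Finset.abs_sum_le_sum_abs _ _).trans (Finset.sum_le_sum hterm)

theorem IsPrimeBernoulliSeq.ae_eq_zero_or_eq_one {X : ℕ → Ω → ℝ} (hX : IsPrimeBernoulliSeq P X)
    {j : ℕ} (hj : 1 ≤ j) : ∀ᵐ ω ∂P, X j ω = 0 ∨ X j ω = 1 := by
  have hm0 : MeasurableSet {ω | X j ω = 0} := hX.measurable j hj (measurableSet_singleton 0)
  have hm1 : MeasurableSet {ω | X j ω = 1} := hX.measurable j hj (measurableSet_singleton 1)
  have hd : Disjoint {ω | X j ω = 0} {ω | X j ω = 1} := by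
    rw [Set.disjoint_left]
    intro ω h0 h1
    simp only [Set.mem_ofPred_eq] at h0 h1
    linarith
  have hp : (0 : ℝ) < 1 + primeSeq j := by positivity
  have h1 : P.real ({ω | X j ω = 0} ∪ {ω | X j ω = 1}) = 1 := by
    rw [measureReal_union hd hm1, hX.prob_zero j hj, hX.prob_one j hj, ← add_div, add_comm,
      div_self hp.ne']
  have h2 : P ({ω | X j ω = 0} ∪ {ω | X j ω = 1}) = 1 := by
    rw [measureReal_def] at h1
    rwa [ENNReal.toReal_eq_one_iff] at h1
  have h3 := (mem_ae_iff_prob_eq_one (hm0.union hm1)).2 h2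
  filter_upwards [h3] with ω hω using hω

theorem IsPrimeBernoulliSeq.integral_eq {X : ℕ → Ω → ℝ} (hX : IsPrimeBernoulliSeq P X)
    {j : ℕ} (hj : 1 ≤ j) : ∫ ω, X j ω ∂P = 1 / (1 + (primeSeq j : ℝ)) := by
  have hm1 : MeasurableSet {ω | X j ω = 1} := hX.measurable j hj (measurableSet_singleton 1)
  rw [← hX.prob_one j hj, ← integral_indicator_one hm1]
  refine integral_congr_ae ?_
  filter_upwards [hX.ae_eq_zero_or_eq_one hj] with ω hω
  rcases hω with h | h <;> simp [Set.indicator, h]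

/-- Approximate size-bias identity for `primeSum`. -/
theorem IsPrimeBernoulliSeq.abs_integral_primeSum_mul_comp_sub_le {X : ℕ → Ω → ℝ}
    (hX : IsPrimeBernoulliSeq P X) (n : ℕ) {C : ℝ}
    (hC : ∑ j ∈ Finset.range n,
      (Real.log (primeSeq (j + 1)) * (1 / (1 + (primeSeq (j + 1) : ℝ)))) ^ 2 ≤ C)
    {F : ℝ → ℝ} (hF : LipschitzWith 1 F) (hF1 : ∀ x, |F x| ≤ 1) :
    |∫ ω, primeSum X n ω * F (primeSum X n ω) ∂P
      - ∑ i ∈ Finset.range n, Real.log (primeSeq (i + 1)) / Real.log (primeSeq n)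
        * (1 / (1 + (primeSeq (i + 1) : ℝ)))
        * ∫ ω, F (primeSum X n ω + Real.log (primeSeq (i + 1)) / Real.log (primeSeq n)) ∂P|
      ≤ C / Real.log (primeSeq n) ^ 2 := by
  set a : ℕ → ℝ := fun i => Real.log (primeSeq (i + 1)) / Real.log (primeSeq n) with ha
  have hX' : ∀ i, Measurable (X (i + 1)) := fun i => hX.measurable _ (by omega)
  have key := abs_integral_sum_mul_comp_sub_le (P := P) (Y := fun i ω => a i * X (i + 1) ω) (a := a)
    (q := fun i => 1 / (1 + (primeSeq (i + 1) : ℝ))) n (fun i => (hX' i).const_mul _)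
    (hX.indep.comp (fun i x => a i * x) fun i => by fun_prop)
    (fun i => div_nonneg (Real.log_natCast_nonneg _) (Real.log_natCast_nonneg _))
    (fun i => by
      filter_upwards [hX.ae_eq_zero_or_eq_one (j := i + 1) (by omega)] with ω hω
      rcases hω with h | h <;> simp [h])
    (fun i => by rw [integral_const_mul, hX.integral_eq (by omega)]) hF hF1
  simp only [primeSum_eq_sum_range]
  refine key.trans ?_
  calc _ = (∑ j ∈ Finset.range n,
        (Real.log (primeSeq (j + 1)) * (1 / (1 + (primeSeq (j + 1) : ℝ)))) ^ 2)
          / Real.log (primeSeq n) ^ 2 := by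
        rw [Finset.sum_div]
        refine Finset.sum_congr rfl fun i _ => ?_
        simp only [ha]
        ring
    _ ≤ _ := div_le_div_of_nonneg_right hC (sq_nonneg _)

end SumsOfIndependent

/-! ### Comparison of the two laws and the final rates -/

/-- By the size-bias identity the left side of the Stein equation has mean zero under the Dickman
law, which identifies the constant `c`. -/
theorem IsDickman.integral_eq_of_stein {μ : Measure ℝ} (hμ : IsDickman 1 μ) {h F : ℝ → ℝ} {c : ℝ}
    (hF : LipschitzWith 1 F) (hF1 : ∀ x, |F x| ≤ 1)
    (hs : ∀ x, x * F x - ∫ u in (0 : ℝ)..1, F (x + u) = h x - c) : ∫ x, h x ∂μ = c := by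
  have := hμ.isProbabilityMeasure
  have hFc := hF.continuous
  have hid : Integrable (fun x : ℝ => x) μ := memLp_one_iff_integrable.1 hμ.memLp_one
  have h1 : Integrable (fun x => x * F x) μ :=
    hid.mul_bdd (c := 1) hFc.aestronglyMeasurable (ae_of_all _ hF1)
  have h2 : Integrable (fun x => ∫ u in (0 : ℝ)..1, F (x + u)) μ := by
    refine (integrable_const (1 : ℝ)).mono' ?_ (ae_of_all _ fun x => ?_)
    · exact (intervalIntegral.continuous_parametric_intervalIntegral_of_continuous'
        (f := fun x u => F (x + u)) (by simp only [Function.uncurry_def]; fun_prop)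
        0 1).aestronglyMeasurable
    · simpa using intervalIntegral.norm_integral_le_of_norm_le_const (a := (0 : ℝ)) (b := 1)
        (f := fun u => F (x + u)) (fun u _ => hF1 _)
  have h3 : ∀ x, h x = (x * F x - ∫ u in (0 : ℝ)..1, F (x + u)) + c := fun x => by
    rw [hs]; ring
  simp only [h3]
  rw [integral_add (by exact h1.sub h2) (integrable_const c), integral_sub h1 h2,
    hμ.integral_mul_eq hFc hF1]
  simp

theorem log_two_le_log_primeSeq (n : ℕ) : Real.log 2 ≤ Real.log (primeSeq n) :=
  Real.log_le_log (by norm_num) (by exact_mod_cast (primeSeq_prime n).two_le)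

theorem log_le_log_primeSeq {n : ℕ} (hn : 1 ≤ n) : Real.log n ≤ Real.log (primeSeq n) := by
  refine Real.log_le_log (by exact_mod_cast hn) ?_
  obtain ⟨m, rfl⟩ : ∃ m, n = m + 1 := ⟨n - 1, by omega⟩
  have := add_two_le_primeSeq m
  exact_mod_cast (by omega : m + 1 ≤ primeSeq (m + 1))

/-- Lets a bound of order `1 / log n` be absorbed into the stated rate. Since `log y ≤ y / e`, the
quotient `Δ_n` is at most `1 / e`, so the square root is at least 1; and `log log n ≥ log log 3 >
0`. -/
theorem dickmanDelta_bounds {n : ℕ} (hn : 3 ≤ n) :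
    Real.log (Real.log 3) / Real.log n ≤ dickmanDelta n * Real.sqrt (-Real.log (dickmanDelta n)) := by
  have hl3 : 1 < Real.log 3 := by
    rw [Real.lt_log_iff_exp_lt (by norm_num)]
    linarith [Real.exp_one_lt_d9]
  have hln : Real.log 3 ≤ Real.log n := Real.log_le_log (by norm_num) (by exact_mod_cast hn)
  have hn0 : 0 < Real.log n := by linarith
  have hll : Real.log (Real.log 3) ≤ Real.log (Real.log n) := Real.log_le_log (by linarith) hln
  have hll0 : 0 < Real.log (Real.log 3) := Real.log_pos hl3
  have hΔ0 : 0 < dickmanDelta n := div_pos (by linarith) hn0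
  have hΔ : dickmanDelta n ≤ Real.exp (-1) := by
    rw [dickmanDelta, div_le_iff₀ hn0]
    have h1 := Real.log_le_sub_one_of_pos (x := Real.exp (-1) * Real.log n) (by positivity)
    rw [Real.log_mul (Real.exp_ne_zero _) hn0.ne', Real.log_exp] at h1
    linarith
  have hs : 1 ≤ Real.sqrt (-Real.log (dickmanDelta n)) := by
    rw [Real.one_le_sqrt]
    have := Real.log_le_log hΔ0 hΔ
    rw [Real.log_exp] at this
    linarith
  calc Real.log (Real.log 3) / Real.log n ≤ dickmanDelta n :=
        div_le_div_of_nonneg_right hll hn0.le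
    _ ≤ _ := le_mul_of_one_le_right hΔ0.le hs

/-- Expectations of `C³` test functions under the laws of `primeSum X n` and of the Dickman
distribution differ by `O(1 / log p_n)`, uniformly in the test function. -/
theorem exists_abs_integral_sub_integral_le :
    ∃ C : ℝ, 0 ≤ C ∧
      ∀ (Ω : Type*) [MeasurableSpace Ω] (P : Measure Ω) [IsProbabilityMeasure P]
        (X : ℕ → Ω → ℝ) (_ : IsPrimeBernoulliSeq P X) (μ : Measure ℝ) (_ : IsDickman 1 μ)
        (n : ℕ) (_ : 1 ≤ n) (h : ℝ → ℝ) (_ : h ∈ smoothTestFunctions 3),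
        |∫ x, h x ∂(P.map (primeSum X n)) - ∫ x, h x ∂μ| ≤ C / Real.log (primeSeq n) := by
  obtain ⟨C₁, hC₁, h₁⟩ := exists_abs_sum_primeSeq_sub_integral_le
  obtain ⟨C₂, hC₂, h₂⟩ := exists_sum_sq_log_div_primeSeq_le
  have hl2 : 0 < Real.log 2 := Real.log_pos (by norm_num)
  refine ⟨C₁ + C₂ / Real.log 2, by positivity, ?_⟩
  intro Ω _ P _ X hX μ hμ n hn h hh
  obtain ⟨F, hF, hF1, c, hs⟩ := exists_dickman_stein_solution_of_mem hh
  have hFc := hF.continuous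
  have hSm := hX.measurable_primeSum n
  set S := primeSum X n with hS
  set L := Real.log (primeSeq n) with hL
  have hL2 : Real.log 2 ≤ L := log_two_le_log_primeSeq n
  have hL0 : 0 < L := hl2.trans_le hL2
  rw [hμ.integral_eq_of_stein hF hF1 hs,
    integral_map hSm.aemeasurable hh.1.continuous.aestronglyMeasurable]
  set a : ℕ → ℝ := fun i => Real.log (primeSeq (i + 1)) / L with ha
  set q : ℕ → ℝ := fun i => 1 / (1 + (primeSeq (i + 1) : ℝ)) with hq
  have hA : |∫ ω, S ω * F (S ω) ∂P - ∑ i ∈ Finset.range n, a i * q i * ∫ ω, F (S ω + a i) ∂P|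
      ≤ C₂ / L ^ 2 := hX.abs_integral_primeSum_mul_comp_sub_le n (h₂ n) hF hF1
  have hFi : ∀ V : Ω → ℝ, Measurable V → Integrable (fun ω => F (V ω)) P := fun V hV =>
    (integrable_const (1 : ℝ)).mono' (hFc.measurable.comp hV).aestronglyMeasurable
      (ae_of_all _ fun ω => hF1 _)
  have hsumi : Integrable (fun ω => ∑ i ∈ Finset.range n, a i * q i * F (S ω + a i)) P :=
    integrable_finsetSum _ fun i _ => (hFi _ (hSm.add_const _)).const_mul _
  have hhi : Integrable (fun ω => h (S ω)) P :=
    (integrable_const (1 : ℝ)).mono'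
      (hh.1.continuous.measurable.comp hSm).aestronglyMeasurable
      (ae_of_all _ fun ω => by simpa using hh.2 0 (by norm_num) (S ω))
  have hinti : Integrable (fun ω => ∫ u in (0 : ℝ)..1, F (S ω + u)) P := by
    refine (integrable_const (1 : ℝ)).mono' ?_ (ae_of_all _ fun ω => ?_)
    · exact ((intervalIntegral.continuous_parametric_intervalIntegral_of_continuous'
        (f := fun x u => F (x + u)) (by simp only [Function.uncurry_def]; fun_prop)
        0 1).measurable.comp hSm).aestronglyMeasurable
    · simpa using intervalIntegral.norm_integral_le_of_norm_le_const (a := (0 : ℝ)) (b := 1)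
        (f := fun u => F (S ω + u)) (fun u _ => hF1 _)
  -- The Stein equation writes `S F(S)` as a sum of bounded terms, so no moment of `S` has to be
  -- computed.
  have hSFi : Integrable (fun ω => S ω * F (S ω)) P := by
    refine ((hhi.sub (integrable_const c)).add hinti).congr (ae_of_all _ fun ω => ?_)
    have := hs (S ω)
    simp only [Pi.add_apply, Pi.sub_apply]
    linarith
  -- Equidistribution is applied for each fixed `ω` to the translate `u ↦ F (S ω + u)`, with a bound
  -- uniform in `ω`.
  have hB : |∫ ω, (∑ i ∈ Finset.range n, a i * q i * F (S ω + a i)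
      - ∫ u in (0 : ℝ)..1, F (S ω + u)) ∂P| ≤ C₁ / L := by
    rw [← Real.norm_eq_abs]
    refine (norm_integral_le_of_norm_le_const (C := C₁ / L) (ae_of_all _ fun ω => ?_)).trans
      (by simp)
    refine h₁ n hn (fun u => F (S ω + u)) ?_ fun u => hF1 _
    refine LipschitzWith.of_dist_le_mul fun u v => ?_
    simpa using hF.dist_le_mul (S ω + u) (S ω + v)
  have hsplit : ∫ ω, h (S ω) ∂P - c
      = (∫ ω, S ω * F (S ω) ∂P - ∑ i ∈ Finset.range n, a i * q i * ∫ ω, F (S ω + a i) ∂P)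
        + ∫ ω, (∑ i ∈ Finset.range n, a i * q i * F (S ω + a i)
          - ∫ u in (0 : ℝ)..1, F (S ω + u)) ∂P := by
    have e1 : ∫ ω, (h (S ω) - c) ∂P = ∫ ω, h (S ω) ∂P - c := by
      rw [integral_sub hhi (integrable_const c)]; simp
    have e2 : ∫ ω, ∑ i ∈ Finset.range n, a i * q i * F (S ω + a i) ∂P
        = ∑ i ∈ Finset.range n, a i * q i * ∫ ω, F (S ω + a i) ∂P := by
      rw [integral_finsetSum _ fun i _ => (hFi _ (hSm.add_const _)).const_mul _]
      simp only [integral_const_mul]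
    rw [integral_sub hsumi hinti, e2, ← e1]
    simp only [← hs]
    rw [integral_sub hSFi hinti]
    ring
  have hC : C₂ / L ^ 2 ≤ C₂ / Real.log 2 / L := by
    rw [div_div, pow_two]
    exact div_le_div_of_nonneg_left hC₂ (by positivity)
      (mul_le_mul_of_nonneg_right hL2 hL0.le)
  rw [hsplit]
  refine (abs_add_le _ _).trans ?_
  rw [add_div]
  linarith

theorem theorem5p3 :
    ∃ C : ℝ, 0 < C ∧
      ∀ (Ω : Type*) [MeasurableSpace Ω] (P : Measure Ω) [IsProbabilityMeasure P]
        (X : ℕ → Ω → ℝ) (_ : IsPrimeBernoulliSeq P X)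
        (Ω' : Type*) [MeasurableSpace Ω'] (P' : Measure Ω') [IsProbabilityMeasure P']
        (Z : Ω' → ℝ) (_ : Measurable Z) (_ : IsDickman 1 (P'.map Z)),
        (∀ n : ℕ, 3 ≤ n →
          smoothWasserstein 3 (P.map (primeSum X n)) (P'.map Z) ≤
            C * dickmanDelta n * Real.sqrt (-Real.log (dickmanDelta n))) ∧
        (fun n : ℕ => smoothWasserstein 3 (P.map (primeSum X n)) (P'.map Z)) =O[atTop]
          (fun n : ℕ => Real.log (Real.log n) ^ (3 / 2 : ℝ) / Real.log n) := by
  obtain ⟨C, hC, hbound⟩ := exists_abs_integral_sub_integral_le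
  have hl3 : 0 < Real.log (Real.log 3) := by
    refine Real.log_pos ?_
    rw [Real.lt_log_iff_exp_lt (by norm_num)]
    linarith [Real.exp_one_lt_d9]
  -- The division by `log log 3` comes from `dickmanDelta_bounds`; the added 1 keeps the constant
  -- positive when `C = 0`.
  refine ⟨C / Real.log (Real.log 3) + 1, by positivity, ?_⟩
  intro Ω _ P _ X hX Ω' _ P' _ Z _ hZ
  have hW : ∀ n : ℕ, 3 ≤ n →
      smoothWasserstein 3 (P.map (primeSum X n)) (P'.map Z) ≤ C / Real.log n := by
    intro n hn
    have hn0 : 0 < Real.log n := Real.log_pos (by exact_mod_cast (by omega : 1 < n))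
    refine (csSup_le (Set.Nonempty.image _ ⟨_, zero_mem_smoothTestFunctions 3⟩) ?_)
    rintro _ ⟨h, hh, rfl⟩
    refine (hbound Ω P X hX _ hZ n (by omega) h hh).trans ?_
    exact div_le_div_of_nonneg_left hC hn0 (log_le_log_primeSeq (by omega))
  refine ⟨fun n hn => (hW n hn).trans ?_, ?_⟩
  · have hΔ := dickmanDelta_bounds hn
    have hn0 : 0 < Real.log n := Real.log_pos (by exact_mod_cast (by omega : 1 < n))
    calc C / Real.log n
        = C / Real.log (Real.log 3) * (Real.log (Real.log 3) / Real.log n) := by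
          field_simp
      _ ≤ (C / Real.log (Real.log 3) + 1) * (Real.log (Real.log 3) / Real.log n) := by
          refine mul_le_mul_of_nonneg_right (by linarith) (by positivity)
      _ ≤ (C / Real.log (Real.log 3) + 1)
            * (dickmanDelta n * Real.sqrt (-Real.log (dickmanDelta n))) :=
          mul_le_mul_of_nonneg_left hΔ (by positivity)
      _ = _ := by ring
  -- This follows directly from the bound `C / log n`, since `log log n ≥ 1` eventually.
  · refine IsBigO.of_bound C ?_
    have hll : Tendsto (fun n : ℕ => Real.log (Real.log n)) atTop atTop :=
      Real.tendsto_log_atTop.comp (Real.tendsto_log_atTop.comp tendsto_natCast_atTop_atTop)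
    filter_upwards [hll.eventually_ge_atTop 1, eventually_ge_atTop 3] with n h1 hn
    have hn0 : 0 < Real.log n := Real.log_pos (by exact_mod_cast (by omega : 1 < n))
    have hW0 : 0 ≤ smoothWasserstein 3 (P.map (primeSum X n)) (P'.map Z) := by
      refine Real.sSup_nonneg ?_
      rintro _ ⟨h, _, rfl⟩
      exact abs_nonneg _
    have h2 : 1 ≤ Real.log (Real.log n) ^ (3 / 2 : ℝ) := Real.one_le_rpow h1 (by norm_num)
    rw [Real.norm_of_nonneg hW0, Real.norm_of_nonneg (by positivity)]
    refine (hW n hn).trans ?_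
    rw [← mul_div_assoc]
    exact div_le_div_of_nonneg_right (le_mul_of_one_le_right hC h2) hn0.le
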